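/- Let $N\in\mathbb N$ and let $\Omega\subset\mathbb R^N$ be a bounded Lipschitz domain. Let $s:\mathbb R^N\times\mathbb R^N\to(0,1)$ be continuous and symmetric, $s(x,y)=s(y,x)$, with $$0<s^-:=\inf_{\overline\Omega\times\overline\Omega}s\le s^+:=\sup_{\overline\Omega\times\overline\Omega}s<1,\qquad 2s(x,y)<N\ \text{ for all }(x,y)\in\overline\Omega\times\overline\Omega .$$ Let $\alpha:\overline\Omega\to\mathbb R$ be continuous with $\alpha^-:=\inf_{\overline\Omega}\alpha>1$, and assume that for every $x\in\overline\Omega$ there is $\varepsilon=\varepsilon(x)>0$ such that, with $\Omega_{x,\varepsilon}:=B_\varepsilon(x)\cap\Omega$, $$\sup_{y\in\Omega_{x,\varepsilon}}\alpha(y)\le\frac{2N}{N-2\inf_{(y,z)\in\Omega_{x,\varepsilon}\times\Omega_{x,\varepsilon}}s(y,z)} .$$ Let $W^{s(\cdot),2}(\Omega)$ be the space of all $u\in L^2(\Omega)$ for which $$\|u\|_{W^{s(\cdot),2}(\Omega)}:=\|u\|_{L^2(\Omega)}+\Big(\iint_{\Omega\times\Omega}\frac{|u(x)-u(y)|^2}{|x-y|^{N+2s(x,y)}}\,dx\,dy\Big)^{1/2}<\infty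 ,$$ let $X$ be the space of all measurable $u:\mathbb R^N\to\mathbb R$ with $u|_\Omega\in L^2(\Omega)$ for which the same double integral, taken over $\mathbb R^{2N}\setminus\big((\mathbb R^N\setminus\Omega)\times(\mathbb R^N\setminus\Omega)\big)$, is finite, and let $L^{\alpha(\cdot)}(\Omega)$ be the space of all measurable $u$ on $\Omega$ with $\int_\Omega|u|^{\alpha(x)}dx<\infty$, with the norm $\|u\|_{\alpha(\cdot)}:=\inf\{t>0:\int_\Omega|u(x)/t|^{\alpha(x)}dx\le1\}$. Then there is a constant $C=C(N,s,\alpha,\Omega)>0$ such that every $u\in W^{s(\cdot),2}(\Omega)$ lies in $L^{\alpha(\cdot)}(\Omega)$ and satisfies $$\|u\|_{\alpha(\cdot)}\le C\,\|u\|_{W^{s(\cdot),2}(\Omega)} ,$$ that is, the embedding $W^{s(\cdot),2}(\Omega)\hookrightarrow L^{\alpha(\cdot)}(\Omega)$ is continuous. In particular, (the restriction to $\Omega$ of) every $u\in X$ lies in $W^{s(\cdot),2}(\Omega)$ and in $L^{\alpha(\cdot)}(\Omega)$ and satisfies the same inequality. -/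

import Mathlib

open MeasureTheory Set
open scoped ENNReal NNReal

namespace VarOrder

/-- The Euclidean space `ℝ^N`. -/
abbrev Rn (N : ℕ) : Type := EuclideanSpace ℝ (Fin N)

/-- A Lipschitz domain: a non-empty connected open set `Ω` which, near each of its boundary points
`p`, is the set of points lying strictly above the graph of a Lipschitz function `g`, in a
Cartesian coordinate system whose last axis points in the direction of a unit vector `ν`; the other
coordinates of `x` are given by its orthogonal projection to the hyperplane `ν^⊥`. -/
structure IsLipschitzDomain {N : ℕ} (Ω : Set (Rn N)) : Prop where
  isOpen : IsOpen Ω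
  isConnected : IsConnected Ω
  boundary : ∀ p ∈ frontier Ω, ∃ r : ℝ, 0 < r ∧ ∃ ν : Rn N, ‖ν‖ = 1 ∧
    ∃ (K : ℝ≥0) (g : (Submodule.span ℝ {ν})ᗮ → ℝ), LipschitzWith K g ∧
      Ω ∩ Metric.ball p r =
        {x ∈ Metric.ball p r |
          g ((Submodule.span ℝ {ν})ᗮ.orthogonalProjectionOnto x) < inner ℝ ν x}

/-- `∬_D |u(x) - u(y)|² / |x - y|^(N + 2 s(x,y)) dx dy` as an element of `[0, ∞]`. -/
noncomputable def energy {N : ℕ} (s : Rn N × Rn N → ℝ) (D : Set (Rn N × Rn N)) (u : Rn N → ℝ) :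
    ℝ≥0∞ :=
  ∫⁻ p in D, ENNReal.ofReal (|u p.1 - u p.2| ^ 2 / ‖p.1 - p.2‖ ^ ((N : ℝ) + 2 * s p))

/-- `u ∈ W^{s(·),2}(Ω)`; only the values of `u` on `Ω` matter. `MemLp` includes measurability. -/
def MemW {N : ℕ} (s : Rn N × Rn N → ℝ) (Ω : Set (Rn N)) (u : Rn N → ℝ) : Prop :=
  MemLp u 2 (volume.restrict Ω) ∧ energy s (Ω ×ˢ Ω) u < ∞

/-- The norm `‖u‖_2 + (∬_{Ω×Ω} |u(x) - u(y)|² / |x - y|^(N + 2 s(x,y)) dx dy)^(1/2)` of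
`W^{s(·),2}(Ω)`; for use on `u` with `MemW s Ω u`. -/
noncomputable def normW {N : ℕ} (s : Rn N × Rn N → ℝ) (Ω : Set (Rn N)) (u : Rn N → ℝ) : ℝ :=
  (eLpNorm u 2 (volume.restrict Ω)).toReal + Real.sqrt (energy s (Ω ×ˢ Ω) u).toReal

/-- `u ∈ X`: `u` is (Lebesgue) measurable on `ℝ^N`, `u|_Ω ∈ L²(Ω)`, and the energy over
`Q = ℝ^{2N} \ ((ℝ^N \ Ω) × (ℝ^N \ Ω))` is finite. -/
def MemX {N : ℕ} (s : Rn N × Rn N → ℝ) (Ω : Set (Rn N)) (u : Rn N → ℝ) : Prop :=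
  AEMeasurable u ∧ MemLp u 2 (volume.restrict Ω) ∧ energy s (Ωᶜ ×ˢ Ωᶜ)ᶜ u < ∞

/-- The modular `∫_Ω |u(x)|^{α(x)} dx` as an element of `[0, ∞]`. -/
noncomputable def modular {N : ℕ} (α : Rn N → ℝ) (Ω : Set (Rn N)) (u : Rn N → ℝ) : ℝ≥0∞ :=
  ∫⁻ x in Ω, ENNReal.ofReal (|u x| ^ α x)

/-- `u ∈ L^{α(·)}(Ω)`, for a bounded exponent `α`. -/
def MemLvar {N : ℕ} (α : Rn N → ℝ) (Ω : Set (Rn N)) (u : Rn N → ℝ) : Prop :=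
  AEMeasurable u (volume.restrict Ω) ∧ modular α Ω u < ∞

/-- The Luxemburg norm `‖u‖_{α(·)} = inf {t > 0 : ∫_Ω |u(x)/t|^{α(x)} dx ≤ 1}` of
`L^{α(·)}(Ω)`; for use on `u` with `MemLvar α Ω u`. -/
noncomputable def luxNorm {N : ℕ} (α : Rn N → ℝ) (Ω : Set (Rn N)) (u : Rn N → ℝ) : ℝ :=
  sInf {t : ℝ | 0 < t ∧ modular α Ω (fun x => u x / t) ≤ 1}

/-- `sup_{B_ε(x) ∩ Ω} α ≤ 2N / (N - 2 inf_{(B_ε(x) ∩ Ω) × (B_ε(x) ∩ Ω)} s)` for some `ε > 0`. -/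
def LocallyAtMostCritical {N : ℕ} (s : Rn N × Rn N → ℝ) (α : Rn N → ℝ) (Ω : Set (Rn N)) (x : Rn N) :
    Prop :=
  ∃ ε : ℝ, 0 < ε ∧
    sSup (α '' (Metric.ball x ε ∩ Ω)) ≤
      2 * (N : ℝ) /
        ((N : ℝ) - 2 * sInf (s '' ((Metric.ball x ε ∩ Ω) ×ˢ (Metric.ball x ε ∩ Ω))))

end VarOrder

/-!
Local critical Sobolev inequalities of constant order are proved near each point of the closure of
the domain and patched together by compactness. No extension operator is needed: of the Lipschitz
condition only the measure density `|B_r(x) ∩ Ω| ≥ c r^N` is used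
(`IsLipschitzDomain.exists_volume_ge`).

*Local inequality.* Near `x₀` let `U = Ω ∩ B_ε(x₀)`, `σ = inf_{U×U} s` and `p = 2N/(N - 2σ)`. If
`ε ≤ 1/2` the energy of constant order `σ` on `U` is at most the energy of variable order. Put
`d(x) = ε - |x - x₀|`, `F = d^(N/2) v` with `v` a truncation of `|u|`, and `P = ∫_U F^p`, which is
finite thanks to the truncation. Fix `x ∈ U` and `r ≤ d(x)/2`. Every `y ∈ B_r(x) ∩ Ω` satisfies
`v(y) ≥ v(x)/2` or `|v(x) - v(y)| ≥ v(x)/2`. Since the weight changes by at most a factor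
`2^(N/2)` on that ball, Markov's inequality bounds the measure of the first kind of points by a
multiple of `P F(x)^(-p)`. For `r^N` a suitable multiple of `P F(x)^(-p)` the second kind therefore
has measure at least `c r^N / 2`, and so `v(x)² ≤ C r^(2σ) G(x)` with
`G(x) = ∫_U |v(x) - v(y)|² / |x - y|^(N + 2σ) dy`; this rearranges to
`F(x)^p ≤ C P^(1 - 2/p) G(x)`. If this `r` exceeds `d(x)/2`, the radius `d(x)/2` and the `L²` norm
`B` of `v` serve instead, as long as `F(x)² > C B²`
(`rpow_weight_mul_le_innerEnergy`). Integration gives `P ≤ C B^p + C P^(1 - 2/p) E`, which is solved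
for `P` (`exists_lintegral_weight_mul_le`), and the truncation is removed by monotone convergence
(`IsLipschitzDomain.exists_lintegral_rpow_le`).

*Patching.* On a smaller ball `α ≤ p`, so `|w|^α ≤ 1 + |w|^p` bounds the modular of `u / T` for all
`T > ‖u‖_W`; compactness of the closure gives one bound `M` on the whole domain
(`IsLipschitzDomain.exists_modular_div_le`). As `α ≥ 1`, dividing further by `M + 1` brings the
modular below `1`, that is `‖u‖_α ≤ (M + 1) ‖u‖_W`.
-/

namespace VarOrder

/-! ### Measure density of Lipschitz domains -/

/-- Interior corkscrew condition: near a point of the closure, `B_r(x) ∩ Ω` contains a ball of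
radius comparable to `r`. At a boundary point that ball is centred straight above `x` in the
direction of the axis, at height `r / 2`. -/
theorem IsLipschitzDomain.exists_ball_subset {N : ℕ} {Ω : Set (Rn N)} (hΩ : IsLipschitzDomain Ω)
    {x₀ : Rn N} (hx₀ : x₀ ∈ closure Ω) :
    ∃ ε : ℝ, 0 < ε ∧ ∃ η : ℝ, 0 < η ∧ ∀ x ∈ Ω ∩ Metric.ball x₀ ε, ∀ r : ℝ, 0 < r → r ≤ ε →
      ∃ z, Metric.ball z (η * r) ⊆ Metric.ball x r ∩ Ω := by
  by_cases hin : x₀ ∈ Ω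
  · obtain ⟨ε, hε, hsub⟩ := Metric.isOpen_iff.1 hΩ.isOpen x₀ hin
    refine ⟨ε / 2, by positivity, 1, one_pos, fun x hx r hr hrε => ⟨x, fun y hy => ?_⟩⟩
    rw [one_mul] at hy
    refine ⟨hy, hsub ?_⟩
    have h1 := hx.2
    rw [Metric.mem_ball] at *
    linarith [dist_triangle y x x₀]
  · have hfr : x₀ ∈ frontier Ω := ⟨hx₀, fun h => hin (interior_subset h)⟩
    obtain ⟨ρ, hρ, ν, hν, K, g, hg, hgraph⟩ := hΩ.boundary x₀ hfr
    have hK : (0 : ℝ) ≤ K := K.2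
    -- A displacement of norm less than `η r` changes the height minus `g` by less than `r / 2`.
    set η : ℝ := 1 / (2 * (1 + K)) with hη
    have hηpos : 0 < η := by positivity
    have hηK : η * (1 + K) = 1 / 2 := by rw [hη]; field_simp
    have hη2 : η ≤ 1 / 2 := by nlinarith
    refine ⟨ρ / 2, by positivity, η, hηpos, fun x hx r hr hrε =>
      ⟨x + (r / 2) • ν, fun z hz => ?_⟩⟩
    obtain ⟨hxΩ, hxb⟩ := hx
    set w := z - (x + (r / 2) • ν) with hw
    have hzw : z = x + (r / 2) • ν + w := by rw [hw]; abel
    have hwn : ‖w‖ < η * r := by rwa [Metric.mem_ball, dist_eq_norm] at hz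
    have hzx : dist z x < r := by
      rw [dist_eq_norm, hzw]
      have : x + (r / 2) • ν + w - x = (r / 2) • ν + w := by abel
      rw [this]
      have h1 := norm_add_le ((r / 2) • ν) w
      rw [norm_smul, hν, Real.norm_of_nonneg (by positivity)] at h1
      nlinarith
    rw [Metric.mem_ball] at hxb
    have hzρ : z ∈ Metric.ball x₀ ρ := by
      rw [Metric.mem_ball]; linarith [dist_triangle z x x₀]
    refine ⟨hzx, ?_⟩
    have hxg : x ∈ Ω ∩ Metric.ball x₀ ρ := ⟨hxΩ, by rw [Metric.mem_ball]; linarith⟩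
    suffices z ∈ Ω ∩ Metric.ball x₀ ρ from this.1
    rw [hgraph] at hxg ⊢
    refine ⟨hzρ, ?_⟩
    have hxg := hxg.2
    set Q := (Submodule.span ℝ {ν})ᗮ.orthogonalProjectionOnto with hQ
    have hPz : Q z = Q x + Q w := by
      rw [hzw, map_add, map_add, map_smul,
        Submodule.orthogonalProjectionOnto_orthogonalComplement_singleton_eq_zero, smul_zero,
        add_zero]
    have hgz : g (Q z) ≤ g (Q x) + K * ‖w‖ := by
      have h1 := hg.dist_le_mul (Q z) (Q x)
      have h2 : ‖Q w‖ ≤ ‖w‖ := Submodule.norm_orthogonalProjectionOnto_apply_le _ w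
      rw [dist_eq_norm, dist_eq_norm, hPz, add_sub_cancel_left, ← hPz] at h1
      have h3 := le_abs_self (g (Q z) - g (Q x))
      rw [← Real.norm_eq_abs] at h3
      nlinarith
    have hiz : inner ℝ ν x + r / 2 - ‖w‖ ≤ inner ℝ ν z := by
      rw [hzw, inner_add_right, inner_add_right, inner_smul_right, real_inner_self_eq_norm_sq, hν]
      have h1 := abs_real_inner_le_norm ν w
      rw [hν] at h1
      have := neg_abs_le (inner ℝ ν w)
      linarith
    have : (1 + K) * ‖w‖ < r / 2 := by
      calc (1 + K) * ‖w‖ < (1 + K) * (η * r) := by gcongr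
        _ = r / 2 := by linear_combination r * hηK
    linarith

theorem IsLipschitzDomain.exists_volume_ge {N : ℕ} {Ω : Set (Rn N)} (hΩ : IsLipschitzDomain Ω)
    {x₀ : Rn N} (hx₀ : x₀ ∈ closure Ω) :
    ∃ ε : ℝ, 0 < ε ∧ ∃ c : ℝ, 0 < c ∧ ∀ x ∈ Ω ∩ Metric.ball x₀ ε, ∀ r : ℝ, 0 < r → r ≤ ε →
      ENNReal.ofReal (c * r ^ (N : ℝ)) ≤ volume (Metric.ball x r ∩ Ω) := by
  obtain ⟨ε, hε, η, hη, h⟩ := hΩ.exists_ball_subset hx₀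
  have hfin : volume (Metric.ball (0 : Rn N) 1) ≠ ∞ := measure_ball_lt_top.ne
  have hpos : 0 < (volume (Metric.ball (0 : Rn N) 1)).toReal :=
    ENNReal.toReal_pos (Metric.measure_ball_pos _ _ one_pos).ne' hfin
  refine ⟨ε, hε, η ^ N * (volume (Metric.ball (0 : Rn N) 1)).toReal, by positivity,
    fun x hx r hr hrε => ?_⟩
  obtain ⟨z, hz⟩ := h x hx r hr hrε
  refine le_trans (le_of_eq ?_) (measure_mono hz)
  rw [Measure.addHaar_ball_of_pos volume z (by positivity), finrank_euclideanSpace_fin]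
  nth_rewrite 2 [← ENNReal.ofReal_toReal hfin]
  rw [← ENNReal.ofReal_mul (by positivity), Real.rpow_natCast]
  congr 1
  ring

/-! ### The pointwise estimate -/

/-- The inner integral `∫_U |v(x) - v(y)|² / |x - y|^(N + 2σ) dy` of the Gagliardo seminorm of
constant order `σ`. -/
noncomputable def innerEnergy {N : ℕ} (σ : ℝ) (U : Set (Rn N)) (v : Rn N → ℝ) (x : Rn N) : ℝ≥0∞ :=
  ∫⁻ y in U, ENNReal.ofReal (|v x - v y| ^ 2 / ‖x - y‖ ^ ((N : ℝ) + 2 * σ))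

/-- Markov's inequality on a subset; `T` need not be measurable. -/
theorem mul_measure_le_setLIntegral {X : Type*} [MeasurableSpace X] {μ : Measure X} {U T : Set X}
    (hU : MeasurableSet U) {g : X → ℝ≥0∞} (hg : AEMeasurable g (μ.restrict U)) {a : ℝ≥0∞}
    (hTU : T ⊆ U) (hT : ∀ y ∈ T, a ≤ g y) : a * μ T ≤ ∫⁻ y in U, g y ∂μ := by
  refine le_trans ?_ (mul_meas_ge_le_lintegral₀ hg a)
  rw [Measure.restrict_apply' hU]
  gcongr
  exact fun y hy => ⟨hT y hy, hTU hy⟩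

/-- If `S ⊆ B_r(x)` has measure at least `c r^N` and `v ≥ v(x)/2` on at most half of that measure,
then `|v(x) - v(y)| ≥ v(x)/2` on the other half, which makes the inner energy at `x` large. -/
theorem le_innerEnergy_of_volume_le {N : ℕ} {σ c r : ℝ} {U S : Set (Rn N)} (hU : MeasurableSet U)
    {v : Rn N → ℝ} (hvm : AEMeasurable v (volume.restrict U)) {x : Rn N}
    (hσ : 0 < σ) (hc : 0 < c) (hr : 0 < r) (hx : 0 < v x) (hSU : S ⊆ U)
    (hSr : S ⊆ Metric.ball x r)
    (hS : ENNReal.ofReal (c * r ^ (N : ℝ)) ≤ volume S)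
    (hlarge : volume {y ∈ S | v x / 2 ≤ v y} ≤ ENNReal.ofReal (c / 2 * r ^ (N : ℝ))) :
    ENNReal.ofReal (c / 8 * v x ^ 2 * r ^ (-(2 * σ))) ≤ innerEnergy σ U v x := by
  have hrN : 0 < r ^ (N : ℝ) := Real.rpow_pos_of_pos hr _
  set T : Set (Rn N) := {y ∈ S | v x / 2 ≤ |v x - v y|} with hT
  have hcover : S ⊆ T ∪ {y ∈ S | v x / 2 ≤ v y} := by
    intro y hy
    by_cases h : v x / 2 ≤ v y
    · exact Or.inr ⟨hy, h⟩
    · exact Or.inl ⟨hy, by linarith [le_abs_self (v x - v y)]⟩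
  have hTvol : ENNReal.ofReal (c / 2 * r ^ (N : ℝ)) ≤ volume T := by
    refine ENNReal.le_of_add_le_add_right (a := ENNReal.ofReal (c / 2 * r ^ (N : ℝ)))
      ENNReal.ofReal_ne_top ?_
    rw [← ENNReal.ofReal_add (by positivity) (by positivity)]
    calc ENNReal.ofReal (c / 2 * r ^ (N : ℝ) + c / 2 * r ^ (N : ℝ))
        = ENNReal.ofReal (c * r ^ (N : ℝ)) := by congr 1; ring
      _ ≤ volume S := hS
      _ ≤ volume T + volume {y ∈ S | v x / 2 ≤ v y} :=
          (measure_mono hcover).trans (measure_union_le _ _)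
      _ ≤ _ := by gcongr
  have hmarkov : ENNReal.ofReal ((v x / 2) ^ 2 / r ^ ((N : ℝ) + 2 * σ)) * volume T ≤
      innerEnergy σ U v x := by
    refine mul_measure_le_setLIntegral hU ?_ (fun y hy => hSU hy.1) ?_
    · have h2 : Measurable fun y : Rn N => ‖x - y‖ ^ ((N : ℝ) + 2 * σ) := by fun_prop
      have h1 : AEMeasurable (fun y => |v x - v y|) (volume.restrict U) :=
        (aemeasurable_const.sub hvm).abs
      exact ((h1.pow_const 2).div h2.aemeasurable).ennreal_ofReal
    · rintro y ⟨hyS, hy⟩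
      -- The kernel has the junk value `0` on the diagonal, which does not meet `T`.
      have hne : x ≠ y := by rintro rfl; simp at hy; linarith
      have hpos : 0 < ‖x - y‖ := norm_pos_iff.2 (sub_ne_zero.2 hne)
      have hle : ‖x - y‖ ≤ r := by
        have := hSr hyS
        rw [Metric.mem_ball, dist_comm, dist_eq_norm] at this
        exact this.le
      gcongr
  refine le_trans (le_of_eq ?_) ((mul_le_mul_right hTvol _).trans hmarkov)
  rw [← ENNReal.ofReal_mul (by positivity)]
  congr 1
  rw [Real.rpow_add hr, Real.rpow_neg hr.le]
  have : 0 < r ^ (2 * σ) := Real.rpow_pos_of_pos hr _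
  field_simp
  ring

/-- The weight `d(x)^(N/2)`, where `d(x) = ε - |x - x₀|` is the distance from a point `x` of the
ball `B_ε(x₀)` to the complement of that ball. -/
noncomputable def weight {N : ℕ} (x₀ : Rn N) (ε : ℝ) (x : Rn N) : ℝ :=
  (ε - dist x x₀) ^ ((N : ℝ) / 2)

theorem measurable_weight {N : ℕ} (x₀ : Rn N) (ε : ℝ) : Measurable (weight x₀ ε) := by
  unfold weight; fun_prop

/-- The pointwise estimate behind the critical inequality. Here `P` bounds the integral of
`F ^ p`, where `F = weight * v`, and `B` bounds the integral of `v ^ 2`. As `2σ/N = 1 - 2/p`, the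
right-hand side scales like `P ^ (1 - 2/p)`, which leaves room to absorb `P` after integration. -/
theorem rpow_weight_mul_le_innerEnergy {N : ℕ} {Ω : Set (Rn N)} (hΩ : MeasurableSet Ω) {x₀ : Rn N}
    {ε c σ p P B : ℝ} (hε1 : ε ≤ 1) (hc : 0 < c)
    (hdens : ∀ x ∈ Ω ∩ Metric.ball x₀ ε, ∀ r : ℝ, 0 < r → r ≤ ε →
      ENNReal.ofReal (c * r ^ (N : ℝ)) ≤ volume (Metric.ball x r ∩ Ω))
    (hσ : 0 < σ) (hσN : 2 * σ < N) (hp : p = 2 * N / (N - 2 * σ))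
    {v : Rn N → ℝ} (hv : ∀ y, 0 ≤ v y)
    (hvm : AEMeasurable v (volume.restrict (Ω ∩ Metric.ball x₀ ε)))
    (hP0 : 0 < P) (hB0 : 0 ≤ B)
    (hP : ∫⁻ y in Ω ∩ Metric.ball x₀ ε, ENNReal.ofReal ((weight x₀ ε y * v y) ^ p) ≤
      ENNReal.ofReal P)
    (hB : ∫⁻ y in Ω ∩ Metric.ball x₀ ε, ENNReal.ofReal (v y ^ 2) ≤ ENNReal.ofReal B)
    {x : Rn N} (hx : x ∈ Ω ∩ Metric.ball x₀ ε)
    (hbig : 2 ^ (N + 3) / c * B < (weight x₀ ε x * v x) ^ 2) :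
    ENNReal.ofReal ((weight x₀ ε x * v x) ^ p) ≤
      ENNReal.ofReal (8 / c * (2 / c * 2 ^ (((N : ℝ) / 2 + 1) * p) * P) ^ (2 * σ / N)) *
        innerEnergy σ (Ω ∩ Metric.ball x₀ ε) v x := by
  have hN : (0 : ℝ) < N := by linarith
  have hNσ : (0 : ℝ) < N - 2 * σ := by linarith
  have hp0 : 0 < p := by rw [hp]; positivity
  have hUm : MeasurableSet (Ω ∩ Metric.ball x₀ ε) := hΩ.inter measurableSet_ball
  set d : ℝ := ε - dist x x₀ with hd
  have hd0 : 0 < d := by have := hx.2; rw [Metric.mem_ball] at this; linarith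
  have hdε : d ≤ ε := by have := dist_nonneg (x := x) (y := x₀); linarith
  set φ : ℝ := weight x₀ ε x with hφ
  have hφd : φ = d ^ ((N : ℝ) / 2) := rfl
  have hφ0 : 0 < φ := Real.rpow_pos_of_pos hd0 _
  have hφ1 : φ ≤ 1 := Real.rpow_le_one hd0.le (hdε.trans hε1) (by positivity)
  have hφ2 : φ ^ 2 = d ^ N := by
    rw [hφd, ← Real.rpow_natCast, ← Real.rpow_mul hd0.le, ← Real.rpow_natCast]
    congr 1; push_cast; ring
  set F : ℝ := φ * v x with hF
  have hF0 : 0 < F := by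
    refine lt_of_le_of_ne (mul_nonneg hφ0.le (hv x)) fun h => ?_
    rw [← h] at hbig
    have : 0 ≤ 2 ^ (N + 3) / c * B := by positivity
    linarith
  have hvx : 0 < v x := pos_of_mul_pos_right hF0 hφ0.le
  set K : ℝ := 2 / c * 2 ^ (((N : ℝ) / 2 + 1) * p) with hK
  have hK0 : 0 < K := by positivity
  -- `R` is the radius at which the bound `P * (2 ^ (N/2 + 1) / F) ^ p` for the measure of the points
  -- with `v y ≥ v x / 2` equals `c / 2 * R ^ N`. The restriction to `d / 2` keeps the ball in
  -- `B_ε(x₀)` and the weight on it comparable to the weight at `x`.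
  set R : ℝ := (K * P * F ^ (-p)) ^ (1 / (N : ℝ)) with hR
  have hR0 : 0 < R := by positivity
  have hRN : R ^ (N : ℝ) = K * P * F ^ (-p) := by
    rw [hR, ← Real.rpow_mul (by positivity), one_div_mul_cancel hN.ne', Real.rpow_one]
  set r : ℝ := min R (d / 2) with hr
  have hr0 : 0 < r := lt_min hR0 (by positivity)
  have hrd : r ≤ d / 2 := min_le_right _ _
  have hdist : ∀ y ∈ Metric.ball x r, d / 2 ≤ ε - dist y x₀ := by
    intro y hy
    rw [Metric.mem_ball] at hy
    linarith [dist_triangle y x x₀]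
  have hSU : Metric.ball x r ∩ Ω ⊆ Ω ∩ Metric.ball x₀ ε := fun y hy =>
    ⟨hy.2, by have := hdist y hy.1; rw [Metric.mem_ball]; linarith⟩
  have hsmall : volume {y ∈ Metric.ball x r ∩ Ω | v x / 2 ≤ v y} ≤
      ENNReal.ofReal (c / 2 * r ^ (N : ℝ)) := by
    have hTU : {y ∈ Metric.ball x r ∩ Ω | v x / 2 ≤ v y} ⊆ Ω ∩ Metric.ball x₀ ε :=
      fun y hy => hSU hy.1
    rcases min_choice R (d / 2) with h | h
    · set A : ℝ := (2 ^ (-((N : ℝ) / 2 + 1)) * F) ^ p with hA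
      have hA0 : 0 < A := by positivity
      have hmarkov := mul_measure_le_setLIntegral (μ := volume) hUm
        (g := fun y => ENNReal.ofReal ((weight x₀ ε y * v y) ^ p))
        ((((measurable_weight x₀ ε).aemeasurable.mul hvm).pow_const p).ennreal_ofReal)
        (a := ENNReal.ofReal A) hTU (by
          rintro y ⟨hyS, hy⟩
          have h1 : (d / 2) ^ ((N : ℝ) / 2) ≤ weight x₀ ε y :=
            Real.rpow_le_rpow (by positivity) (hdist y hyS.1) (by positivity)
          have h2 : 2 ^ (-((N : ℝ) / 2 + 1)) * F = (d / 2) ^ ((N : ℝ) / 2) * (v x / 2) := by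
            rw [hF, hφd, Real.div_rpow hd0.le zero_le_two, Real.rpow_neg zero_le_two,
              Real.rpow_add_one two_ne_zero]
            field_simp
          refine ENNReal.ofReal_le_ofReal (Real.rpow_le_rpow (by positivity) ?_ hp0.le)
          rw [h2]
          exact mul_le_mul h1 hy (by positivity) ((by positivity : (0 : ℝ) ≤ _).trans h1))
      have hle : volume {y ∈ Metric.ball x r ∩ Ω | v x / 2 ≤ v y} ≤
          ENNReal.ofReal P / ENNReal.ofReal A := by
        rw [ENNReal.le_div_iff_mul_le (by simp [hA0]) (by simp), mul_comm]
        exact hmarkov.trans hP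
      refine hle.trans (le_of_eq ?_)
      rw [← ENNReal.ofReal_div_of_pos hA0, hr, h, hRN]
      congr 1
      rw [hA, hK, Real.mul_rpow (by positivity) hF0.le, ← Real.rpow_mul zero_le_two, neg_mul,
        Real.rpow_neg zero_le_two, Real.rpow_neg hF0.le]
      field_simp
    -- At radius `d / 2` the `L²` bound suffices: `φ ^ 2 = d ^ N` turns `hbig` into the right bound.
    · have hmarkov := mul_measure_le_setLIntegral (μ := volume) hUm
        (g := fun y => ENNReal.ofReal (v y ^ 2)) ((hvm.pow_const 2).ennreal_ofReal)
        (a := ENNReal.ofReal ((v x / 2) ^ 2)) hTU (by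
          rintro y ⟨hyS, hy⟩
          gcongr)
      have hle : volume {y ∈ Metric.ball x r ∩ Ω | v x / 2 ≤ v y} ≤
          ENNReal.ofReal B / ENNReal.ofReal ((v x / 2) ^ 2) := by
        rw [ENNReal.le_div_iff_mul_le (by left; simp; positivity) (by simp), mul_comm]
        exact hmarkov.trans hB
      refine hle.trans ?_
      rw [← ENNReal.ofReal_div_of_pos (by positivity), hr, h, Real.rpow_natCast]
      refine ENNReal.ofReal_le_ofReal ?_
      rw [div_le_iff₀ (by positivity)]
      have h3 : B < c / 2 ^ (N + 3) * F ^ 2 := by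
        calc B = c / 2 ^ (N + 3) * (2 ^ (N + 3) / c * B) := by field_simp
          _ < _ := by gcongr
      refine h3.le.trans (le_of_eq ?_)
      rw [hF, mul_pow, hφ2, div_pow]
      field_simp
      ring
  have hmain := le_innerEnergy_of_volume_le (σ := σ) hUm hvm hσ hc hr0 hvx hSU inter_subset_left
    (hdens x hx r hr0 (by linarith)) hsmall
  have hRr : R ^ (-(2 * σ)) ≤ r ^ (-(2 * σ)) :=
    Real.rpow_le_rpow_of_nonpos hr0 (min_le_left _ _) (by linarith)
  have hFv : F ≤ v x := by nlinarith
  have hexp : F ^ p = 8 / c * (K * P) ^ (2 * σ / N) * (c / 8 * F ^ 2 * R ^ (-(2 * σ))) := by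
    have h1 : R ^ (-(2 * σ)) = ((K * P) ^ (2 * σ / N))⁻¹ * F ^ (p - 2) := by
      rw [hR, ← Real.rpow_mul (by positivity), Real.mul_rpow (by positivity) (by positivity),
        ← Real.rpow_mul hF0.le, ← Real.rpow_neg (by positivity)]
      congr 2
      · field_simp
      · rw [hp]; field_simp; ring
    have h2 : F ^ p = F ^ 2 * F ^ (p - 2) := by
      rw [← Real.rpow_natCast F 2, ← Real.rpow_add hF0]; congr 1; push_cast; ring
    rw [h1, h2]
    have : 0 < (K * P) ^ (2 * σ / N) := by positivity
    field_simp
  rw [hexp, ENNReal.ofReal_mul (by positivity)]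
  refine mul_le_mul_right (le_trans (ENNReal.ofReal_le_ofReal ?_) hmain) _
  gcongr

/-! ### The weighted critical inequality for bounded functions -/

/-- Solving `P ≤ a + b P^(1 - 2/p)` for `P`. -/
theorem le_of_le_add_mul_rpow {P a b p : ℝ} (hp : 0 < p) (hP : 0 < P) (ha : 0 ≤ a) (hb : 0 ≤ b)
    (h : P ≤ a + b * P ^ (1 - 2 / p)) : P ≤ 2 * a + (2 * b) ^ (p / 2) := by
  have h0 : 0 ≤ (2 * b) ^ (p / 2) := by positivity
  by_cases hcase : P ≤ 2 * a
  · linarith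
  have h1 : P ≤ 2 * b * P ^ (1 - 2 / p) := by linarith
  have h2 : P ^ (2 / p) ≤ 2 * b := by
    rw [Real.rpow_sub hP, Real.rpow_one] at h1
    have : 0 < P ^ (2 / p) := by positivity
    rw [← mul_div_assoc, le_div_iff₀ this, mul_comm P] at h1
    exact le_of_mul_le_mul_right h1 hP
  have h3 : P ≤ (2 * b) ^ (p / 2) := by
    calc P = (P ^ (2 / p)) ^ (p / 2) := by
          rw [← Real.rpow_mul hP.le, div_mul_div_cancel₀ hp.ne', div_self two_ne_zero,
            Real.rpow_one]
      _ ≤ _ := by gcongr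
  linarith

/-- The weighted critical Sobolev inequality of constant order `σ` on `Ω ∩ B_ε(x₀)`, for bounded
functions. The constant does not depend on the bound `M`, which only serves to make the left-hand
side finite. -/
theorem exists_lintegral_weight_mul_le {N : ℕ} {Ω : Set (Rn N)} (hΩ : MeasurableSet Ω) {x₀ : Rn N}
    {ε c σ p : ℝ} (hε1 : ε ≤ 1) (hc : 0 < c)
    (hdens : ∀ x ∈ Ω ∩ Metric.ball x₀ ε, ∀ r : ℝ, 0 < r → r ≤ ε →
      ENNReal.ofReal (c * r ^ (N : ℝ)) ≤ volume (Metric.ball x r ∩ Ω))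
    (hσ : 0 < σ) (hσN : 2 * σ < N) (hp : p = 2 * N / (N - 2 * σ)) :
    ∃ C : ℝ, 0 ≤ C ∧ ∀ (v : Rn N → ℝ) (M B E : ℝ), (∀ y, 0 ≤ v y) → (∀ y, v y ≤ M) →
      AEMeasurable v (volume.restrict (Ω ∩ Metric.ball x₀ ε)) → 0 ≤ B → 0 ≤ E →
      ∫⁻ y in Ω ∩ Metric.ball x₀ ε, ENNReal.ofReal (v y ^ 2) ≤ ENNReal.ofReal (B ^ 2) →
      ∫⁻ x in Ω ∩ Metric.ball x₀ ε, innerEnergy σ (Ω ∩ Metric.ball x₀ ε) v x ≤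
        ENNReal.ofReal (E ^ 2) →
      ∫⁻ y in Ω ∩ Metric.ball x₀ ε, ENNReal.ofReal ((weight x₀ ε y * v y) ^ p) ≤
        ENNReal.ofReal (C * (B + E) ^ p) := by
  have hN : (0 : ℝ) < N := by linarith
  have hNσ : (0 : ℝ) < N - 2 * σ := by linarith
  have hp0 : 0 < p := by rw [hp]; positivity
  set U := Ω ∩ Metric.ball x₀ ε with hU
  have hUfin : volume U ≠ ∞ :=
    (lt_of_le_of_lt (measure_mono inter_subset_right) measure_ball_lt_top).ne
  have hUm : MeasurableSet U := hΩ.inter measurableSet_ball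
  set D : ℝ := 2 ^ (N + 3) / c with hD
  set K : ℝ := 2 / c * 2 ^ (((N : ℝ) / 2 + 1) * p) with hK
  have hK0 : 0 < K := by positivity
  set L : ℝ := 8 / c * K ^ (2 * σ / N) with hL
  have hL0 : 0 < L := by positivity
  refine ⟨2 * (D ^ (p / 2) * (volume U).toReal) + (2 * L) ^ (p / 2), by positivity,
    fun v M B E hv hvM hvm hB0 hE0 hB hE => ?_⟩
  have hsq : ∀ t : ℝ, 0 ≤ t → (t ^ 2) ^ (p / 2) = t ^ p := fun t ht => by
    rw [← Real.rpow_natCast, ← Real.rpow_mul ht]; congr 1; push_cast; ring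
  have hwv : ∀ y ∈ U, 0 ≤ weight x₀ ε y ∧ weight x₀ ε y ≤ 1 := by
    intro y hy
    have h1 := hy.2
    rw [Metric.mem_ball] at h1
    exact ⟨Real.rpow_nonneg (by linarith) _, Real.rpow_le_one (by linarith)
      (by linarith [dist_nonneg (x := y) (y := x₀)]) (by positivity)⟩
  have hfin : ∫⁻ y in U, ENNReal.ofReal ((weight x₀ ε y * v y) ^ p) ≠ ∞ := by
    have h1 : ∫⁻ y in U, ENNReal.ofReal ((weight x₀ ε y * v y) ^ p) ≤
        ∫⁻ y in U, ENNReal.ofReal (M ^ p) := by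
      refine setLIntegral_mono' hUm fun y hy => ENNReal.ofReal_le_ofReal ?_
      obtain ⟨h0, h1⟩ := hwv y hy
      have h2 : weight x₀ ε y * v y ≤ M := by nlinarith [hv y, hvM y]
      have h3 := mul_nonneg h0 (hv y)
      gcongr
    refine (lt_of_le_of_lt h1 ?_).ne
    rw [setLIntegral_const]
    exact ENNReal.mul_lt_top ENNReal.ofReal_lt_top hUfin.lt_top
  set P : ℝ := (∫⁻ y in U, ENNReal.ofReal ((weight x₀ ε y * v y) ^ p)).toReal with hPdef
  have hPeq : ∫⁻ y in U, ENNReal.ofReal ((weight x₀ ε y * v y) ^ p) = ENNReal.ofReal P :=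
    (ENNReal.ofReal_toReal hfin).symm
  rcases (ENNReal.toReal_nonneg (a := ∫⁻ y in U,
    ENNReal.ofReal ((weight x₀ ε y * v y) ^ p))).eq_or_lt with h0 | hP0
  · rw [hPeq, hPdef, ← h0, ENNReal.ofReal_zero]; exact zero_le
  rw [← hPdef] at hP0
  have hpt : ∀ x ∈ U, ENNReal.ofReal ((weight x₀ ε x * v x) ^ p) ≤
      ENNReal.ofReal ((D * B ^ 2) ^ (p / 2)) +
        ENNReal.ofReal (L * P ^ (2 * σ / N)) * innerEnergy σ U v x := by
    intro x hx
    by_cases hbig : D * B ^ 2 < (weight x₀ ε x * v x) ^ 2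
    · refine le_trans ?_ le_add_self
      have h1 := rpow_weight_mul_le_innerEnergy hΩ hε1 hc hdens hσ hσN hp hv hvm hP0 (sq_nonneg B)
        hPeq.le hB hx hbig
      rwa [Real.mul_rpow hK0.le hP0.le, ← mul_assoc] at h1
    · refine le_trans (ENNReal.ofReal_le_ofReal ?_) le_self_add
      rw [← hsq _ (mul_nonneg (hwv x hx).1 (hv x))]
      exact Real.rpow_le_rpow (sq_nonneg _) (not_lt.1 hbig) (by positivity)
  have hint : ENNReal.ofReal P ≤
      ENNReal.ofReal ((D * B ^ 2) ^ (p / 2) * (volume U).toReal +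
        L * P ^ (2 * σ / N) * E ^ 2) := by
    rw [← hPeq]
    refine (setLIntegral_mono' hUm hpt).trans ?_
    rw [lintegral_add_left measurable_const, setLIntegral_const,
      lintegral_const_mul' _ _ ENNReal.ofReal_ne_top,
      ENNReal.ofReal_add (by positivity) (by positivity),
      ENNReal.ofReal_mul (p := (D * B ^ 2) ^ (p / 2)) (by positivity),
      ENNReal.ofReal_toReal hUfin,
      ENNReal.ofReal_mul (p := L * P ^ (2 * σ / N)) (by positivity)]
    gcongr
  rw [ENNReal.ofReal_le_ofReal_iff (by positivity)] at hint
  have hexp : 2 * σ / N = 1 - 2 / p := by rw [hp]; field_simp; ring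
  have hsol := le_of_le_add_mul_rpow (a := (D * B ^ 2) ^ (p / 2) * (volume U).toReal)
    (b := L * E ^ 2) hp0 hP0 (by positivity) (by positivity)
    (by rw [← hexp]; linarith)
  rw [hPeq]
  refine ENNReal.ofReal_le_ofReal (hsol.trans ?_)
  rw [← mul_assoc 2 L, Real.mul_rpow (by positivity) (by positivity),
    Real.mul_rpow (by positivity) (by positivity), hsq _ hB0, hsq _ hE0]
  have h1 : B ^ p ≤ (B + E) ^ p := by gcongr; linarith
  have h2 : E ^ p ≤ (B + E) ^ p := by gcongr; linarith
  calc 2 * (D ^ (p / 2) * B ^ p * (volume U).toReal) + (2 * L) ^ (p / 2) * E ^ p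
      = 2 * (D ^ (p / 2) * (volume U).toReal) * B ^ p + (2 * L) ^ (p / 2) * E ^ p := by ring
    _ ≤ 2 * (D ^ (p / 2) * (volume U).toReal) * (B + E) ^ p +
          (2 * L) ^ (p / 2) * (B + E) ^ p := by gcongr
    _ = _ := by ring

/-! ### The local critical inequality in the variable-order space -/

theorem normW_nonneg {N : ℕ} (s : Rn N × Rn N → ℝ) (Ω : Set (Rn N)) (u : Rn N → ℝ) :
    0 ≤ normW s Ω u := by
  unfold normW; positivity

theorem MemW.lintegral_sq_eq {N : ℕ} {s : Rn N × Rn N → ℝ} {Ω : Set (Rn N)} {u : Rn N → ℝ}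
    (hu : MemW s Ω u) :
    ∫⁻ y in Ω, ENNReal.ofReal (|u y| ^ 2) =
      ENNReal.ofReal ((eLpNorm u 2 (volume.restrict Ω)).toReal ^ 2) := by
  have h1 := eLpNorm_nnreal_pow_eq_lintegral (f := u) (μ := volume.restrict Ω) (p := 2) two_ne_zero
  rw [ENNReal.ofReal_pow ENNReal.toReal_nonneg, ENNReal.ofReal_toReal hu.1.2.ne]
  simp only [ENNReal.coe_ofNat, NNReal.coe_ofNat, ENNReal.rpow_ofNat] at h1
  rw [h1]
  refine lintegral_congr fun y => ?_
  rw [ENNReal.ofReal_pow (abs_nonneg _), Real.enorm_eq_ofReal_abs]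

/-- On a set of diameter at most `1`, lowering the order of differentiability does not increase the
energy. -/
theorem lintegral_innerEnergy_le_energy {N : ℕ} {s : Rn N × Rn N → ℝ} {Ω U : Set (Rn N)}
    (hUm : MeasurableSet U) (hUΩ : U ⊆ Ω) {σ : ℝ} {u v : Rn N → ℝ}
    (hvm : AEMeasurable v (volume.restrict U)) (hvu : ∀ x y, |v x - v y| ≤ |u x - u y|)
    (hdiam : ∀ x ∈ U, ∀ y ∈ U, ‖x - y‖ ≤ 1) (hs : ∀ p ∈ U ×ˢ U, σ ≤ s p) :
    ∫⁻ x in U, innerEnergy σ U v x ≤ energy s (Ω ×ˢ Ω) u := by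
  have hm : AEMeasurable (fun p : Rn N × Rn N =>
      ENNReal.ofReal (|v p.1 - v p.2| ^ 2 / ‖p.1 - p.2‖ ^ ((N : ℝ) + 2 * σ)))
      ((volume.restrict U).prod (volume.restrict U)) := by
    have h1 : AEMeasurable (fun p : Rn N × Rn N => v p.1)
        ((volume.restrict U).prod (volume.restrict U)) := hvm.comp_fst
    have h2 : AEMeasurable (fun p : Rn N × Rn N => v p.2)
        ((volume.restrict U).prod (volume.restrict U)) := hvm.comp_snd
    have h3 : Measurable fun p : Rn N × Rn N => ‖p.1 - p.2‖ ^ ((N : ℝ) + 2 * σ) := by fun_prop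
    exact (((h1.sub h2).abs.pow_const 2).div h3.aemeasurable).ennreal_ofReal
  unfold innerEnergy energy
  rw [← lintegral_prod _ hm, Measure.prod_restrict, ← Measure.volume_eq_prod]
  refine le_trans (setLIntegral_mono' (hUm.prod hUm) fun p hp => ENNReal.ofReal_le_ofReal ?_)
    (lintegral_mono_set (prod_mono hUΩ hUΩ))
  rcases eq_or_ne p.1 p.2 with h | h
  · simp [h]
  · have hpos : 0 < ‖p.1 - p.2‖ := norm_pos_iff.2 (sub_ne_zero.2 h)
    have h1 : ‖p.1 - p.2‖ ^ ((N : ℝ) + 2 * s p) ≤ ‖p.1 - p.2‖ ^ ((N : ℝ) + 2 * σ) :=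
      Real.rpow_le_rpow_of_exponent_ge hpos (hdiam _ hp.1 _ hp.2) (by linarith [hs p hp])
    have h2 : 0 < ‖p.1 - p.2‖ ^ ((N : ℝ) + 2 * s p) := Real.rpow_pos_of_pos hpos _
    have h3 := hvu p.1 p.2
    gcongr

/-- The critical Sobolev inequality on a small neighbourhood in `Ω` of a point of its closure, for
an order `σ` below the variable order near that point. -/
theorem IsLipschitzDomain.exists_lintegral_rpow_le {N : ℕ} {Ω : Set (Rn N)}
    (hΩ : IsLipschitzDomain Ω) {x₀ : Rn N} (hx₀ : x₀ ∈ closure Ω) {s : Rn N × Rn N → ℝ}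
    {ε σ p : ℝ} (hε : 0 < ε)
    (hs : ∀ q ∈ (Metric.ball x₀ ε ∩ Ω) ×ˢ (Metric.ball x₀ ε ∩ Ω), σ ≤ s q)
    (hσ : 0 < σ) (hσN : 2 * σ < N) (hp : p = 2 * N / (N - 2 * σ)) :
    ∃ δ : ℝ, 0 < δ ∧ δ ≤ ε ∧ ∃ C : ℝ, 0 ≤ C ∧ ∀ u : Rn N → ℝ, MemW s Ω u →
      ∫⁻ y in Ω ∩ Metric.ball x₀ δ, ENNReal.ofReal (|u y| ^ p) ≤
        ENNReal.ofReal (C * normW s Ω u ^ p) := by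
  have hN : (0 : ℝ) < N := by linarith
  have hNσ : (0 : ℝ) < N - 2 * σ := by linarith
  have hp0 : 0 < p := by rw [hp]; positivity
  have hΩm : MeasurableSet Ω := hΩ.isOpen.measurableSet
  obtain ⟨ε₁, hε₁, c, hc, hdens⟩ := hΩ.exists_volume_ge hx₀
  set τ : ℝ := min (min ε ε₁) (1 / 2) with hτ
  have hτ0 : 0 < τ := by positivity
  have hτε : τ ≤ ε := (min_le_left _ _).trans (min_le_left _ _)
  have hτε₁ : τ ≤ ε₁ := (min_le_left _ _).trans (min_le_right _ _)
  have hτ2 : τ ≤ 1 / 2 := min_le_right _ _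
  obtain ⟨C, hC0, hC⟩ := exists_lintegral_weight_mul_le hΩm (x₀ := x₀) (ε := τ) (c := c) (σ := σ)
    (by linarith) hc (fun x hx r hr hrτ => hdens x
      ⟨hx.1, Metric.ball_subset_ball hτε₁ hx.2⟩ r hr (hrτ.trans hτε₁)) hσ hσN hp
  set U := Ω ∩ Metric.ball x₀ τ with hU
  have hUm : MeasurableSet U := hΩm.inter measurableSet_ball
  have hUΩ : U ⊆ Ω := inter_subset_left
  set w : ℝ := (τ / 2) ^ ((N : ℝ) / 2) with hw
  have hw0 : 0 < w := by positivity
  refine ⟨τ / 2, by positivity, by linarith, C / w ^ p, by positivity, fun u hu => ?_⟩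
  set V := Ω ∩ Metric.ball x₀ (τ / 2) with hV
  have hVm : MeasurableSet V := hΩm.inter measurableSet_ball
  have hVU : V ⊆ U := inter_subset_inter_right _ (Metric.ball_subset_ball (by linarith))
  have hum : AEMeasurable u (volume.restrict Ω) := hu.1.1.aemeasurable
  have htrunc : ∀ n : ℕ, ∫⁻ y in V, ENNReal.ofReal ((min |u y| n) ^ p) ≤
      ENNReal.ofReal (C / w ^ p * normW s Ω u ^ p) := by
    intro n
    have hvm : AEMeasurable (fun y => min |u y| (n : ℝ)) (volume.restrict U) :=
      ((hum.mono_set hUΩ).abs).min aemeasurable_const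
    have hv0 : ∀ y, 0 ≤ min |u y| (n : ℝ) := fun y => le_min (abs_nonneg _) n.cast_nonneg
    have h1 := hC (fun y => min |u y| (n : ℝ)) n (eLpNorm u 2 (volume.restrict Ω)).toReal
      (Real.sqrt (energy s (Ω ×ˢ Ω) u).toReal) hv0 (fun y => min_le_right _ _) hvm
      ENNReal.toReal_nonneg (Real.sqrt_nonneg _)
      (by
        rw [← hu.lintegral_sq_eq]
        refine (lintegral_mono_set hUΩ).trans (lintegral_mono fun y => ENNReal.ofReal_le_ofReal ?_)
        exact pow_le_pow_left₀ (hv0 y) (min_le_left _ _) 2)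
      (by
        rw [Real.sq_sqrt ENNReal.toReal_nonneg, ENNReal.ofReal_toReal hu.2.ne]
        refine lintegral_innerEnergy_le_energy hUm hUΩ hvm (fun x y => ?_) (fun x hx y hy => ?_)
          (fun q hq => hs q ?_)
        · refine (abs_min_sub_min_le_max _ _ _ _).trans ?_
          rw [sub_self, abs_zero, max_eq_left (abs_nonneg _)]
          exact abs_abs_sub_abs_le _ _
        · rw [← dist_eq_norm]
          have h2 := hx.2
          have h3 := hy.2
          rw [Metric.mem_ball] at h2 h3
          linarith [dist_triangle_right x y x₀]
        · exact ⟨⟨Metric.ball_subset_ball hτε hq.1.2, hq.1.1⟩,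
            Metric.ball_subset_ball hτε hq.2.2, hq.2.1⟩)
    change _ ≤ ENNReal.ofReal (C * normW s Ω u ^ p) at h1
    have h2 : ENNReal.ofReal (w ^ p) * ∫⁻ y in V, ENNReal.ofReal ((min |u y| n) ^ p) ≤
        ENNReal.ofReal (C * normW s Ω u ^ p) := by
      rw [← lintegral_const_mul' _ _ ENNReal.ofReal_ne_top]
      refine le_trans ?_ h1
      refine le_trans (setLIntegral_mono' hVm fun y hy => ?_) (lintegral_mono_set hVU)
      have h3 : w ≤ weight x₀ τ y := by
        have := hy.2
        rw [Metric.mem_ball] at this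
        exact Real.rpow_le_rpow (by positivity) (by linarith) (by positivity)
      have h4 := hv0 y
      rw [← ENNReal.ofReal_mul (by positivity), ← Real.mul_rpow hw0.le h4]
      gcongr
    have h5 : C / w ^ p * normW s Ω u ^ p = C * normW s Ω u ^ p / w ^ p := by ring
    rw [h5, ENNReal.ofReal_div_of_pos (by positivity),
      ENNReal.le_div_iff_mul_le (by left; simp; positivity) (by simp), mul_comm]
    exact h2
  calc ∫⁻ y in V, ENNReal.ofReal (|u y| ^ p)
      ≤ ∫⁻ y in V, ⨆ n : ℕ, ENNReal.ofReal ((min |u y| n) ^ p) := by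
        refine lintegral_mono fun y => ?_
        refine le_trans (le_of_eq ?_) (le_iSup _ ⌈|u y|⌉₊)
        rw [min_eq_left (Nat.le_ceil _)]
    _ = ⨆ n : ℕ, ∫⁻ y in V, ENNReal.ofReal ((min |u y| n) ^ p) := by
        refine lintegral_iSup' (fun n => ?_) (ae_of_all _ fun y m n hmn => ?_)
        · exact ((((hum.mono_set (hVU.trans hUΩ)).abs).min
            aemeasurable_const).pow_const p).ennreal_ofReal
        · have : (m : ℝ) ≤ n := Nat.cast_le.2 hmn
          have h0 : 0 ≤ min |u y| (m : ℝ) := le_min (abs_nonneg _) m.cast_nonneg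
          dsimp only
          gcongr
    _ ≤ _ := iSup_le htrunc

/-! ### Patching and the Luxemburg norm -/

theorem IsLipschitzDomain.exists_local_modular_le {N : ℕ} {Ω : Set (Rn N)}
    (hΩ : IsLipschitzDomain Ω) {x₀ : Rn N} (hx₀ : x₀ ∈ closure Ω) {s : Rn N × Rn N → ℝ}
    (hs_range : ∀ p, 0 < s p ∧ s p < 1) (hs_minus : 0 < sInf (s '' (closure Ω ×ˢ closure Ω)))
    (hN : ∀ p ∈ closure Ω ×ˢ closure Ω, 2 * s p < (N : ℝ)) {α : Rn N → ℝ}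
    (hα_bdd : BddAbove (α '' Ω)) (hα0 : ∀ x ∈ Ω, 0 ≤ α x)
    (hcrit : LocallyAtMostCritical s α Ω x₀) :
    ∃ δ : ℝ, 0 < δ ∧ ∃ M : ℝ≥0, ∀ u : Rn N → ℝ, MemW s Ω u → ∀ T : ℝ, normW s Ω u < T →
      ∫⁻ x in Ω ∩ Metric.ball x₀ δ, ENNReal.ofReal (|u x / T| ^ α x) ≤ M := by
  obtain ⟨ε, hε, hle⟩ := hcrit
  set Uε := Metric.ball x₀ ε ∩ Ω with hUε
  set σ : ℝ := sInf (s '' (Uε ×ˢ Uε)) with hσdef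
  have hbdd : ∀ A : Set (Rn N × Rn N), BddBelow (s '' A) := fun A =>
    ⟨0, by rintro _ ⟨q, -, rfl⟩; exact (hs_range q).1.le⟩
  obtain ⟨z, hzΩ, hzd⟩ := Metric.mem_closure_iff.1 hx₀ ε hε
  have hzU : z ∈ Uε := ⟨by rwa [Metric.mem_ball, dist_comm], hzΩ⟩
  have hsub : Uε ⊆ closure Ω := fun y hy => subset_closure hy.2
  have hσs : ∀ q ∈ Uε ×ˢ Uε, σ ≤ s q := fun q hq => csInf_le (hbdd _) (mem_image_of_mem s hq)
  have hσ : 0 < σ := hs_minus.trans_le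
    (csInf_le_csInf (hbdd _) ⟨_, mem_image_of_mem s (mk_mem_prod hzU hzU)⟩
      (image_mono (prod_mono hsub hsub)))
  have hσN : 2 * σ < N := by
    linarith [hN (z, z) ⟨hsub hzU, hsub hzU⟩, hσs (z, z) ⟨hzU, hzU⟩]
  set p : ℝ := 2 * N / (N - 2 * σ) with hp
  obtain ⟨δ, hδ, hδε, C, hC0, hC⟩ := hΩ.exists_lintegral_rpow_le hx₀ hε hσs hσ hσN hp
  have hαp : ∀ x ∈ Ω ∩ Metric.ball x₀ δ, α x ≤ p := fun x hx =>
    (le_csSup (hα_bdd.mono (image_mono inter_subset_right))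
      (mem_image_of_mem α (⟨Metric.ball_subset_ball hδε hx.2, hx.1⟩ : x ∈ Uε))).trans hle
  have hVfin : volume (Ω ∩ Metric.ball x₀ δ) ≠ ∞ :=
    (lt_of_le_of_lt (measure_mono inter_subset_right) measure_ball_lt_top).ne
  have hVm : MeasurableSet (Ω ∩ Metric.ball x₀ δ) :=
    hΩ.isOpen.measurableSet.inter measurableSet_ball
  refine ⟨δ, hδ, (volume (Ω ∩ Metric.ball x₀ δ)).toNNReal + C.toNNReal, fun u hu T hT => ?_⟩
  have hW0 := normW_nonneg s Ω u
  have hT0 : 0 < T := hW0.trans_lt hT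
  have hp0 : 0 < p := by have : (0 : ℝ) < N - 2 * σ := by linarith
                         have : (0 : ℝ) < N := by linarith
                         positivity
  calc ∫⁻ x in Ω ∩ Metric.ball x₀ δ, ENNReal.ofReal (|u x / T| ^ α x)
      ≤ ∫⁻ x in Ω ∩ Metric.ball x₀ δ, (1 + ENNReal.ofReal ((T ^ p)⁻¹) *
          ENNReal.ofReal (|u x| ^ p)) := by
        refine setLIntegral_mono' hVm fun x hx => ?_
        rw [← ENNReal.ofReal_mul (by positivity), ← ENNReal.ofReal_one,
          ← ENNReal.ofReal_add zero_le_one (by positivity)]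
        refine ENNReal.ofReal_le_ofReal ?_
        have h1 : (T ^ p)⁻¹ * |u x| ^ p = |u x / T| ^ p := by
          rw [abs_div, abs_of_pos hT0, Real.div_rpow (abs_nonneg _) hT0.le]; ring
        rw [h1]
        have h0 : 0 ≤ |u x / T| ^ p := by positivity
        rcases le_total |u x / T| 1 with h | h
        · linarith [Real.rpow_le_one (abs_nonneg _) h (hα0 x hx.1)]
        · linarith [Real.rpow_le_rpow_of_exponent_le h (hαp x hx)]
    _ = volume (Ω ∩ Metric.ball x₀ δ) + ENNReal.ofReal ((T ^ p)⁻¹) *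
          ∫⁻ x in Ω ∩ Metric.ball x₀ δ, ENNReal.ofReal (|u x| ^ p) := by
        rw [lintegral_add_left measurable_const, setLIntegral_const, one_mul,
          lintegral_const_mul' _ _ ENNReal.ofReal_ne_top]
    _ ≤ volume (Ω ∩ Metric.ball x₀ δ) + ENNReal.ofReal C := by
        gcongr
        refine (mul_le_mul_right (hC u hu) _).trans ?_
        rw [← ENNReal.ofReal_mul (by positivity)]
        refine ENNReal.ofReal_le_ofReal ?_
        rw [inv_mul_le_iff₀ (by positivity), mul_comm]
        gcongr
    _ = _ := by
        rw [ENNReal.coe_add, ENNReal.coe_toNNReal hVfin]; rfl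

/-- A bound for the modular of `u / T` that is uniform over `u` and `T > ‖u‖_W`. The strict
inequality makes `T` positive even if `‖u‖_W = 0`. -/
theorem IsLipschitzDomain.exists_modular_div_le {N : ℕ} {Ω : Set (Rn N)}
    (hΩ : IsLipschitzDomain Ω) (hΩb : Bornology.IsBounded Ω) {s : Rn N × Rn N → ℝ}
    (hs_range : ∀ p, 0 < s p ∧ s p < 1) (hs_minus : 0 < sInf (s '' (closure Ω ×ˢ closure Ω)))
    (hN : ∀ p ∈ closure Ω ×ˢ closure Ω, 2 * s p < (N : ℝ)) {α : Rn N → ℝ}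
    (hα_bdd : BddAbove (α '' Ω)) (hα0 : ∀ x ∈ Ω, 0 ≤ α x)
    (hcrit : ∀ x ∈ closure Ω, LocallyAtMostCritical s α Ω x) :
    ∃ M : ℝ≥0, ∀ u : Rn N → ℝ, MemW s Ω u → ∀ T : ℝ, normW s Ω u < T →
      modular α Ω (fun x => u x / T) ≤ M := by
  have hmain : ∃ M : ℝ≥0, ∀ u : Rn N → ℝ, MemW s Ω u → ∀ T : ℝ, normW s Ω u < T →
      ∫⁻ x in Ω ∩ closure Ω, ENNReal.ofReal (|u x / T| ^ α x) ≤ M := by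
    refine IsCompact.induction_on (s := closure Ω)
      (p := fun A => ∃ M : ℝ≥0, ∀ u : Rn N → ℝ, MemW s Ω u → ∀ T : ℝ, normW s Ω u < T →
        ∫⁻ x in Ω ∩ A, ENNReal.ofReal (|u x / T| ^ α x) ≤ M)
      hΩb.isCompact_closure ⟨0, fun u _ T _ => by simp⟩ ?_ ?_ ?_
    · rintro A B hAB ⟨M, hM⟩
      exact ⟨M, fun u hu T hT => (lintegral_mono_set (inter_subset_inter_right _ hAB)).trans
        (hM u hu T hT)⟩
    · rintro A B ⟨M₁, hM₁⟩ ⟨M₂, hM₂⟩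
      refine ⟨M₁ + M₂, fun u hu T hT => ?_⟩
      rw [inter_union_distrib_left, ENNReal.coe_add]
      exact (lintegral_union_le _ _ _).trans (add_le_add (hM₁ u hu T hT) (hM₂ u hu T hT))
    · intro x hx
      obtain ⟨δ, hδ, M, hM⟩ := hΩ.exists_local_modular_le hx hs_range hs_minus hN hα_bdd hα0
        (hcrit x hx)
      exact ⟨Metric.ball x δ, mem_nhdsWithin_of_mem_nhds (Metric.ball_mem_nhds x hδ), M, hM⟩
  rwa [inter_eq_left.2 subset_closure] at hmain

theorem modular_div_le {N : ℕ} {Ω : Set (Rn N)} (hΩm : MeasurableSet Ω) {α : Rn N → ℝ}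
    (hα1 : ∀ x ∈ Ω, 1 ≤ α x) (u : Rn N → ℝ) {t : ℝ} (ht : 1 ≤ t) :
    modular α Ω (fun x => u x / t) ≤ ENNReal.ofReal t⁻¹ * modular α Ω u := by
  have ht0 : 0 < t := one_pos.trans_le ht
  unfold modular
  rw [← lintegral_const_mul' _ _ ENNReal.ofReal_ne_top]
  refine setLIntegral_mono' hΩm fun x hx => ?_
  rw [← ENNReal.ofReal_mul (by positivity)]
  refine ENNReal.ofReal_le_ofReal ?_
  rw [abs_div, abs_of_pos ht0, Real.div_rpow (abs_nonneg _) ht0.le, div_eq_inv_mul]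
  gcongr
  exact Real.self_le_rpow_of_one_le ht (hα1 x hx)

theorem modular_lt_top_of_div {N : ℕ} {Ω : Set (Rn N)} (hΩm : MeasurableSet Ω) {α : Rn N → ℝ}
    (hα_bdd : BddAbove (α '' Ω)) {u : Rn N → ℝ} {t : ℝ} (ht : 1 ≤ t)
    (h : modular α Ω (fun x => u x / t) < ∞) : modular α Ω u < ∞ := by
  obtain ⟨a, ha⟩ := hα_bdd
  have ht0 : 0 < t := one_pos.trans_le ht
  refine lt_of_le_of_lt ?_ (ENNReal.mul_lt_top (ENNReal.ofReal_lt_top (r := t ^ a)) h)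
  unfold modular
  rw [← lintegral_const_mul' _ _ ENNReal.ofReal_ne_top]
  refine setLIntegral_mono' hΩm fun x hx => ?_
  rw [← ENNReal.ofReal_mul (by positivity)]
  refine ENNReal.ofReal_le_ofReal ?_
  calc |u x| ^ α x = t ^ α x * |u x / t| ^ α x := by
        rw [← Real.mul_rpow ht0.le (abs_nonneg _), abs_div, abs_of_pos ht0,
          mul_div_cancel₀ _ ht0.ne']
    _ ≤ _ := by
        gcongr
        exact ha (mem_image_of_mem α hx)

theorem MemX.memW {N : ℕ} {s : Rn N × Rn N → ℝ} {Ω : Set (Rn N)} {u : Rn N → ℝ}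
    (hu : MemX s Ω u) : MemW s Ω u :=
  have hsub : Ω ×ˢ Ω ⊆ (Ωᶜ ×ˢ Ωᶜ)ᶜ := fun _ hq hq' => hq'.1 hq.1
  ⟨hu.2.1, lt_of_le_of_lt (lintegral_mono_set hsub) hu.2.2⟩

end VarOrder

theorem theorem3p1 (N : ℕ) (Ω : Set (VarOrder.Rn N))
    (hΩ : VarOrder.IsLipschitzDomain Ω) (hΩb : Bornology.IsBounded Ω)
    (s : VarOrder.Rn N × VarOrder.Rn N → ℝ)
    (hs_cont : Continuous s)
    (hs_range : ∀ p, 0 < s p ∧ s p < 1)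
    (hs_symm : ∀ x y, s (x, y) = s (y, x))
    (hs_minus : 0 < sInf (s '' (closure Ω ×ˢ closure Ω)))
    (hs_plus : sSup (s '' (closure Ω ×ˢ closure Ω)) < 1)
    (hN : ∀ p ∈ closure Ω ×ˢ closure Ω, 2 * s p < (N : ℝ))
    (α : VarOrder.Rn N → ℝ)
    (hα_cont : ContinuousOn α (closure Ω))
    (hα_minus : 1 < sInf (α '' closure Ω))
    (hα_crit : ∀ x ∈ closure Ω, VarOrder.LocallyAtMostCritical s α Ω x) :
    ∃ C : ℝ, 0 < C ∧
      (∀ u : VarOrder.Rn N → ℝ, VarOrder.MemX s Ω u →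
        VarOrder.MemW s Ω u ∧ VarOrder.MemLvar α Ω u ∧
          VarOrder.luxNorm α Ω u ≤ C * VarOrder.normW s Ω u) ∧
      (∀ u : VarOrder.Rn N → ℝ, VarOrder.MemW s Ω u →
        VarOrder.MemLvar α Ω u ∧
          VarOrder.luxNorm α Ω u ≤ C * VarOrder.normW s Ω u) := by
  have hcpt := hΩb.isCompact_closure.image_of_continuousOn hα_cont
  have hα_bdd : BddAbove (α '' Ω) := hcpt.bddAbove.mono (image_mono subset_closure)
  have hα1 : ∀ x ∈ Ω, 1 ≤ α x := fun x hx =>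
    hα_minus.le.trans (csInf_le hcpt.bddBelow (mem_image_of_mem α (subset_closure hx)))
  have hΩm := hΩ.isOpen.measurableSet
  obtain ⟨M, hM⟩ := hΩ.exists_modular_div_le hΩb hs_range hs_minus hN hα_bdd
    (fun x hx => zero_le_one.trans (hα1 x hx)) hα_crit
  set l : ℝ := M + 1 with hl
  have hl1 : 1 ≤ l := by rw [hl]; linarith [M.2]
  have hl0 : 0 < l := one_pos.trans_le hl1
  have key : ∀ u : VarOrder.Rn N → ℝ, VarOrder.MemW s Ω u → VarOrder.MemLvar α Ω u ∧
      VarOrder.luxNorm α Ω u ≤ l * VarOrder.normW s Ω u := by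
    intro u hu
    have hW0 := VarOrder.normW_nonneg s Ω u
    refine ⟨⟨hu.1.1.aemeasurable, ?_⟩, ?_⟩
    · exact VarOrder.modular_lt_top_of_div hΩm hα_bdd (t := VarOrder.normW s Ω u + 1)
        (by linarith) ((hM u hu _ (lt_add_one _)).trans_lt ENNReal.coe_lt_top)
    · refine le_of_forall_gt_imp_ge_of_dense fun t ht => ?_
      have hWt : VarOrder.normW s Ω u < t / l := by rwa [lt_div_iff₀ hl0, mul_comm]
      refine csInf_le ⟨0, fun r hr => hr.1.le⟩
        ⟨(mul_nonneg hl0.le hW0).trans_lt ht, ?_⟩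
      have h1 := VarOrder.modular_div_le hΩm hα1 (fun x => u x / (t / l)) hl1
      have h2 : (fun x => u x / (t / l) / l) = fun x => u x / t := by
        funext x; rw [div_div, div_mul_cancel₀ _ hl0.ne']
      rw [h2] at h1
      refine h1.trans ((mul_le_mul_right (hM u hu _ hWt) _).trans ?_)
      rw [← ENNReal.ofReal_coe_nnreal, ← ENNReal.ofReal_mul (by positivity),
        ENNReal.ofReal_le_one, inv_mul_le_iff₀ hl0, hl]
      linarith
  exact ⟨l, hl0, fun u hu => ⟨hu.memW, key u hu.memW⟩, key⟩
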